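/- For a finite simple graph $G$ and an integer $t\ge 0$ let $k_t(G)$ be the number of cliques (sets of pairwise adjacent vertices) of size $t$ in $G$, and let $i_t(G)$ be the number of independent sets of size $t$ in $G$. Fix an integer $t\ge 3$ and let \[ \mu_t=\frac14\cdot\frac{t-2+\sqrt{t^2+4t-4}}{t-1},\qquad f_t(x)=x^t(1-x)^{t-1}\bigl(1+(t-1)x\bigr). \] A word $w$ in the symbols $+$ and $-$ is the code of the following threshold graph on $|w|+1$ vertices: start from a single vertex (which is not encoded), read $w$ from right to left, and for each symbol $+$ add a new vertex adjacent to all previous vertices, for each symbol $-$ add a new isolated vertex. Theorem. (a) There is a constant $C$, depending only on $t$, such that every graph $G$ on $n$ vertices satisfies \[ k_t(G)\,i_t(G)\le\left(\frac{n^t}{t!}\right)^2 f_t(\mu_t)+C\,n^{2t-1}. \] (b) This bound is tight up to the error term, and threshold graphs with code $(+)^{(1-\mu_t)n}(-)^{\mu_t n}$ or $(-)^{(1-\mu_t)n}(+)^{\mu_t n}$, with exponents rounded, attain it. Precisely: for every $n\ge1$ there are integers $a,b\ge0$ with $a+b=n-1$, $|a-(1-\mu_t)n|\le1$ and $|b-\mu_t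 n|\le 1$; and there is a constant $C'$, depending only on $t$, such that for all $n\ge 1$ and all such $a,b$, both the threshold graph $T$ with code $(+)^a(-)^b$ and the threshold graph $T$ with code $(-)^a(+)^b$ (which have $n$ vertices) satisfy \[ \left|k_t(T)\,i_t(T)-\left(\frac{n^t}{t!}\right)^2 f_t(\mu_t)\right|\le C'\,n^{2t-1}. \] -/

import Mathlib

/-- `k_t(G)`: the number of cliques of size `t` in `G`. -/
noncomputable def numCliques {V : Type*} (G : SimpleGraph V) (t : ℕ) : ℕ :=
  {s : Finset V | G.IsNClique t s}.ncard

/-- `i_t(G)`: the number of independent sets of size `t` in `G`. -/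
noncomputable def numIndepSets {V : Type*} (G : SimpleGraph V) (t : ℕ) : ℕ :=
  {s : Finset V | G.IsNIndepSet t s}.ncard

/-- `μ_t = (1/4) (t - 2 + √(t² + 4t - 4)) / (t - 1)`. -/
noncomputable def muT (t : ℕ) : ℝ :=
  1 / 4 * (((t : ℝ) - 2 + Real.sqrt ((t : ℝ) ^ 2 + 4 * (t : ℝ) - 4)) / ((t : ℝ) - 1))

/-- `f_t(x) = x^t (1 - x)^(t-1) (1 + (t - 1) x)`. -/
noncomputable def fT (t : ℕ) (x : ℝ) : ℝ :=
  x ^ t * (1 - x) ^ (t - 1) * (1 + ((t : ℝ) - 1) * x)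

/-- The graph obtained from `G` by adding one new vertex (`none`), isolated. -/
def addIsolated {V : Type*} (G : SimpleGraph V) : SimpleGraph (Option V) where
  Adj
    | some u, some v => G.Adj u v
    | _, _ => False
  symm := ⟨by rintro (_ | u) (_ | v) h <;> first | exact h | exact G.adj_symm h⟩
  loopless := ⟨by rintro (_ | u) h <;> first | exact h | exact G.irrefl h⟩

/-- The graph obtained from `G` by adding one new vertex (`none`), adjacent to all vertices
of `G`. -/
def addDominating {V : Type*} (G : SimpleGraph V) : SimpleGraph (Option V) where
  Adj
    | some u, some v => G.Adj u v
    | none, none => False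
    | _, _ => True
  symm := ⟨by rintro (_ | u) (_ | v) h <;> first | exact h | exact G.adj_symm h⟩
  loopless := ⟨by rintro (_ | u) h <;> first | exact h | exact G.irrefl h⟩

/-- The symbols of the code of a threshold graph: `plus` adds a dominating vertex, `minus` adds
an isolated vertex. -/
inductive CodeSymbol : Type
  | plus : CodeSymbol
  | minus : CodeSymbol

/-- The vertices of the threshold graph with a given code: an initial vertex, and one more vertex
for each symbol. -/
def ThresholdVertex : List CodeSymbol → Type
  | [] => Unit
  | _ :: c => Option (ThresholdVertex c)

/-- The threshold graph with a given code. It starts from a single vertex, which is not encoded.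
The code is processed from right to left: the last symbol of the list is the first vertex that is
added, the head of the list is the last one. A code of length `n - 1` gives a graph on `n`
vertices. -/
def thresholdGraph : (c : List CodeSymbol) → SimpleGraph (ThresholdVertex c)
  | [] => (⊥ : SimpleGraph Unit)
  | CodeSymbol.plus :: c => addDominating (thresholdGraph c)
  | CodeSymbol.minus :: c => addIsolated (thresholdGraph c)

/-- The code `(+)^a (-)^b`. -/
def codePlusMinus (a b : ℕ) : List CodeSymbol :=
  List.replicate a CodeSymbol.plus ++ List.replicate b CodeSymbol.minus

/-- The code `(-)^a (+)^b`. -/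
def codeMinusPlus (a b : ℕ) : List CodeSymbol :=
  List.replicate a CodeSymbol.minus ++ List.replicate b CodeSymbol.plus

/-- The pair `(a, b)` is a rounding of `((1 - μ_t) n, μ_t n)` to natural numbers with sum `n - 1`,
the length of the code of a threshold graph on `n` vertices. -/
def IsRounding (t n a b : ℕ) : Prop :=
  a + b + 1 = n ∧ |(a : ℝ) - (1 - muT t) * n| ≤ 1 ∧ |(b : ℝ) - muT t * n| ≤ 1

/-! Compressing edges from one vertex to another decreases no clique count and no independent set
count. Repeated compression nests all neighbourhoods in that of one vertex; then some vertex is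
dominating or isolated, and induction on the rest reduces everything to threshold graphs
(`exists_thresholdGraph_dominating`).

Put m = t - 1. A code is a lattice path: X and Y count the symbols `+` and `-` read so far.
Classifying a clique by its earliest added vertex gives k_t as the sum of binomials (X choose m)
along the path, and i_t as the sum of (Y choose m). Since m! (X choose m) ≤ X^m, power sums suffice.
If the path ends at (x, y), let A be the mean of (X/x)^m over the vertical steps and B the mean of
(Y/y)^m over the horizontal ones. The trade-off is A ≤ (1 - B)^m or B ≤ (1 - A)^m, with equality for
the three-block paths + - + and - + -. It is preserved when a step is appended (`AreaBound.step`).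

There remains an optimization over three blocks (`three_block_le`). On a level set of the
independent set density, the clique density first decreases and then increases, so its maximum is at
an end, where one block vanishes. Two blocks give `fT`, whose maximum on [0, 1] is at `muT`. The
upper bound needs no error term. For tightness, both counts are explicit binomials on two-block
codes. -/

/-! ### Counts under isomorphism, complement and addition of a vertex -/

theorem numCliques_congr {V W : Type*} {G : SimpleGraph V} {H : SimpleGraph W} (e : G ≃g H)
    (t : ℕ) : numCliques G t = numCliques H t := by
  have key : {s : Finset W | H.IsNClique t s} =
      Finset.map e.toEquiv.toEmbedding '' {s : Finset V | G.IsNClique t s} := by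
    ext s
    simp only [Set.mem_ofPred_eq, Set.mem_image, SimpleGraph.isNClique_iff]
    constructor
    · rintro ⟨hs, hc⟩
      refine ⟨s.map e.symm.toEquiv.toEmbedding, ⟨?_, by simpa using hc⟩, ?_⟩
      · intro x hx y hy hxy
        simp only [Finset.coe_map, Set.mem_image, Finset.mem_coe] at hx hy
        obtain ⟨x, hx, rfl⟩ := hx
        obtain ⟨y, hy, rfl⟩ := hy
        exact e.symm.map_adj_iff.2 (hs hx hy fun h => hxy (by rw [h]))
      · ext x
        simp only [Finset.mem_map_equiv]
        exact iff_of_eq (congrArg (· ∈ s) (e.apply_symm_apply x))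
    · rintro ⟨s, ⟨hs, hc⟩, rfl⟩
      refine ⟨?_, by simpa using hc⟩
      intro x hx y hy hxy
      simp only [Finset.coe_map, Set.mem_image, Finset.mem_coe] at hx hy
      obtain ⟨x, hx, rfl⟩ := hx
      obtain ⟨y, hy, rfl⟩ := hy
      exact e.map_adj_iff.2 (hs hx hy fun h => hxy (by rw [h]))
  unfold numCliques
  rw [key, Set.ncard_image_of_injective _ (Finset.map_injective _)]

theorem numIndepSets_eq_numCliques_compl {V : Type*} (G : SimpleGraph V) (t : ℕ) :
    numIndepSets G t = numCliques Gᶜ t := by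
  simp only [numIndepSets, numCliques, SimpleGraph.isNIndepSet_iff, SimpleGraph.isNClique_iff,
    SimpleGraph.isClique_compl]

theorem numIndepSets_congr {V W : Type*} {G : SimpleGraph V} {H : SimpleGraph W} (e : G ≃g H)
    (t : ℕ) : numIndepSets G t = numIndepSets H t := by
  have e' : Gᶜ ≃g Hᶜ := ⟨e.toEquiv, by
    intro x y
    simp only [SimpleGraph.compl_adj, ne_eq, EmbeddingLike.apply_eq_iff_eq]
    exact and_congr_right fun _ => not_congr e.map_adj_iff⟩
  rw [numIndepSets_eq_numCliques_compl, numIndepSets_eq_numCliques_compl, numCliques_congr e']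

theorem numCliques_zero {V : Type*} (G : SimpleGraph V) : numCliques G 0 = 1 := by
  have : {s : Finset V | G.IsNClique 0 s} = {∅} := by
    ext s
    simp only [Set.mem_ofPred_eq, SimpleGraph.isNClique_iff, Finset.card_eq_zero,
      Set.mem_singleton_iff]
    constructor
    · exact fun h => h.2
    · rintro rfl
      simp
  rw [numCliques, this, Set.ncard_singleton]

theorem numCliques_one {V : Type*} (G : SimpleGraph V) : numCliques G 1 = Nat.card V := by
  have : {s : Finset V | G.IsNClique 1 s} = (fun v : V => ({v} : Finset V)) '' Set.univ := by
    ext s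
    simp only [Set.mem_ofPred_eq, SimpleGraph.isNClique_iff, Finset.card_eq_one, Set.image_univ,
      Set.mem_range]
    constructor
    · rintro ⟨-, v, rfl⟩
      exact ⟨v, rfl⟩
    · rintro ⟨v, rfl⟩
      exact ⟨by simp, v, rfl⟩
  rw [numCliques, this, Set.ncard_image_of_injective _ Finset.singleton_injective,
    Set.ncard_univ]

theorem isClique_map_some_addDominating {V : Type*} {G : SimpleGraph V} {s : Finset V} :
    (addDominating G).IsClique (s.map Function.Embedding.some : Finset (Option V)) ↔
      G.IsClique s := by
  constructor
  · intro h x hx y hy hxy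
    exact h (x := some x) (by simpa using hx) (y := some y) (by simpa using hy) (by simpa using hxy)
  · intro h x hx y hy hxy
    simp only [Finset.coe_map, Set.mem_image, Finset.mem_coe] at hx hy
    obtain ⟨x, hx, rfl⟩ := hx
    obtain ⟨y, hy, rfl⟩ := hy
    exact h hx hy fun h => hxy (by rw [h])

theorem isClique_insertNone_addDominating {V : Type*} {G : SimpleGraph V} {s : Finset V} :
    (addDominating G).IsClique (Finset.insertNone s : Finset (Option V)) ↔ G.IsClique s := by
  constructor
  · intro h x hx y hy hxy
    exact h (x := some x) (by simpa using hx) (y := some y) (by simpa using hy) (by simpa using hxy)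
  · rintro h (_ | x) hx (_ | y) hy hxy
    · exact absurd rfl hxy
    · trivial
    · trivial
    · exact h (by simpa using hx) (by simpa using hy) (by simpa using hxy)

theorem eq_map_some_eraseNone_of_none_notMem {V : Type*} {s : Finset (Option V)}
    (h : none ∉ s) : (Finset.eraseNone s).map Function.Embedding.some = s := by
  classical
  rw [Finset.map_some_eraseNone, Finset.erase_eq_of_notMem h]

theorem eq_insertNone_eraseNone_of_none_mem {V : Type*} {s : Finset (Option V)}
    (h : none ∈ s) : Finset.insertNone (Finset.eraseNone s) = s := by
  classical
  rw [Finset.insertNone_eraseNone, Finset.insert_eq_of_mem h]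

theorem numCliques_addDominating {V : Type*} [Finite V] (G : SimpleGraph V) (t : ℕ) :
    numCliques (addDominating G) (t + 1) = numCliques G (t + 1) + numCliques G t := by
  have key : {s : Finset (Option V) | (addDominating G).IsNClique (t + 1) s} =
      Finset.map Function.Embedding.some '' {s : Finset V | G.IsNClique (t + 1) s} ∪
        Finset.insertNone '' {s : Finset V | G.IsNClique t s} := by
    ext s
    simp only [Set.mem_ofPred_eq, Set.mem_union, Set.mem_image, SimpleGraph.isNClique_iff]
    constructor
    · rintro ⟨hs, hc⟩
      by_cases h : none ∈ s
      · right
        have h' := eq_insertNone_eraseNone_of_none_mem h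
        refine ⟨Finset.eraseNone s, ⟨?_, ?_⟩, h'⟩
        · rw [← isClique_insertNone_addDominating, h']
          exact hs
        · rw [← h', Finset.card_insertNone] at hc
          omega
      · left
        have h' := eq_map_some_eraseNone_of_none_notMem h
        refine ⟨Finset.eraseNone s, ⟨?_, ?_⟩, h'⟩
        · rw [← isClique_map_some_addDominating, h']
          exact hs
        · rw [← h', Finset.card_map] at hc
          exact hc
    · rintro (⟨s, ⟨hs, hc⟩, rfl⟩ | ⟨s, ⟨hs, hc⟩, rfl⟩)
      · exact ⟨isClique_map_some_addDominating.2 hs, by simpa using hc⟩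
      · exact ⟨isClique_insertNone_addDominating.2 hs, by simpa using hc⟩
  unfold numCliques
  rw [key, Set.ncard_union_eq _ (Set.toFinite _) (Set.toFinite _),
    Set.ncard_image_of_injective _ (Finset.map_injective _),
    Set.ncard_image_of_injective _ Finset.insertNone.injective]
  rw [Set.disjoint_left]
  rintro _ ⟨s, -, rfl⟩ ⟨s', -, h⟩
  have : none ∈ Finset.map Function.Embedding.some s := h ▸ Finset.none_mem_insertNone
  simp at this

theorem numCliques_addIsolated {V : Type*} (G : SimpleGraph V) (t : ℕ) :
    numCliques (addIsolated G) (t + 2) = numCliques G (t + 2) := by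
  have key : {s : Finset (Option V) | (addIsolated G).IsNClique (t + 2) s} =
      Finset.map Function.Embedding.some '' {s : Finset V | G.IsNClique (t + 2) s} := by
    ext s
    simp only [Set.mem_ofPred_eq, Set.mem_image, SimpleGraph.isNClique_iff]
    constructor
    · rintro ⟨hs, hc⟩
      have h : none ∉ s := by
        intro h
        obtain ⟨x, hx, hne⟩ := Finset.exists_mem_ne (by omega : 1 < s.card) none
        exact hs (Finset.mem_coe.2 h) (Finset.mem_coe.2 hx) hne.symm
      have h' := eq_map_some_eraseNone_of_none_notMem h
      refine ⟨Finset.eraseNone s, ⟨?_, ?_⟩, h'⟩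
      · intro x hx y hy hxy
        exact hs (x := some x) (by simpa using hx) (y := some y) (by simpa using hy)
          (by simpa using hxy)
      · rw [← h', Finset.card_map] at hc
        exact hc
    · rintro ⟨s, ⟨hs, hc⟩, rfl⟩
      refine ⟨?_, by simpa using hc⟩
      intro x hx y hy hxy
      simp only [Finset.coe_map, Set.mem_image, Finset.mem_coe] at hx hy
      obtain ⟨x, hx, rfl⟩ := hx
      obtain ⟨y, hy, rfl⟩ := hy
      exact hs hx hy fun h => hxy (by rw [h])
  unfold numCliques
  rw [key, Set.ncard_image_of_injective _ (Finset.map_injective _)]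

theorem compl_addIsolated {V : Type*} (G : SimpleGraph V) :
    (addIsolated G)ᶜ = addDominating Gᶜ := by
  ext (_ | x) (_ | y) <;> simp [addIsolated, addDominating]

theorem compl_addDominating {V : Type*} (G : SimpleGraph V) :
    (addDominating G)ᶜ = addIsolated Gᶜ := by
  ext (_ | x) (_ | y) <;> simp [addIsolated, addDominating]

/-! ### Counts in threshold graphs as sums along the code -/

instance finite_thresholdVertex : (c : List CodeSymbol) → Finite (ThresholdVertex c)
  | [] => inferInstanceAs (Finite Unit)
  | _ :: c => by
    have := finite_thresholdVertex c
    exact inferInstanceAs (Finite (Option (ThresholdVertex c)))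

theorem card_thresholdVertex (c : List CodeSymbol) :
    Nat.card (ThresholdVertex c) = c.length + 1 := by
  induction c with
  | nil => exact Nat.card_unique (α := Unit)
  | cons s c ih =>
    exact (Finite.card_option (α := ThresholdVertex c)).trans (by rw [ih, List.length_cons])

/-- The complementary symbol. -/
def CodeSymbol.flip : CodeSymbol → CodeSymbol
  | plus => minus
  | minus => plus

/-- The complement of a threshold graph is the threshold graph of the complementary code. -/
def complThresholdIso : (c : List CodeSymbol) →
    ((thresholdGraph c)ᶜ ≃g thresholdGraph (c.map CodeSymbol.flip))
  | [] => ⟨Equiv.refl Unit, by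
      intro x y
      obtain rfl : x = y := Subsingleton.elim (α := Unit) x y
      exact iff_of_false (SimpleGraph.irrefl _) (SimpleGraph.irrefl _)⟩
  | CodeSymbol.plus :: c =>
    ⟨(Equiv.optionCongr (complThresholdIso c).toEquiv :
        Option (ThresholdVertex c) ≃ Option (ThresholdVertex (c.map CodeSymbol.flip))), by
      intro x y
      change (addIsolated (thresholdGraph (c.map CodeSymbol.flip))).Adj _ _ ↔
        (addDominating (thresholdGraph c))ᶜ.Adj x y
      rw [compl_addDominating]
      rcases x with _ | x <;> rcases y with _ | y
      · exact Iff.rfl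
      · exact Iff.rfl
      · exact Iff.rfl
      · exact (complThresholdIso c).map_adj_iff⟩
  | CodeSymbol.minus :: c =>
    ⟨(Equiv.optionCongr (complThresholdIso c).toEquiv :
        Option (ThresholdVertex c) ≃ Option (ThresholdVertex (c.map CodeSymbol.flip))), by
      intro x y
      change (addDominating (thresholdGraph (c.map CodeSymbol.flip))).Adj _ _ ↔
        (addIsolated (thresholdGraph c))ᶜ.Adj x y
      rw [compl_addIsolated]
      rcases x with _ | x <;> rcases y with _ | y
      · exact Iff.rfl
      · exact Iff.rfl
      · exact Iff.rfl
      · exact (complThresholdIso c).map_adj_iff⟩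

theorem numIndepSets_thresholdGraph (c : List CodeSymbol) (t : ℕ) :
    numIndepSets (thresholdGraph c) t = numCliques (thresholdGraph (c.map CodeSymbol.flip)) t := by
  rw [numIndepSets_eq_numCliques_compl, numCliques_congr (complThresholdIso c)]

/-- The sum of `X.choose m` over all prefixes of the code `c`, where `X` is `x` plus the number of
symbols `+` in the prefix. -/
def prefixChooseSum (m : ℕ) : ℕ → List CodeSymbol → ℕ
  | x, [] => x.choose m
  | x, CodeSymbol.plus :: c => x.choose m + prefixChooseSum m (x + 1) c
  | x, CodeSymbol.minus :: c => x.choose m + prefixChooseSum m x c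

/-- Pascal's rule at every prefix. It matches the effect of a dominating vertex on clique counts. -/
theorem prefixChooseSum_succ (m x : ℕ) (c : List CodeSymbol) :
    prefixChooseSum (m + 1) (x + 1) c =
      prefixChooseSum m x c + prefixChooseSum (m + 1) x c := by
  induction c generalizing x with
  | nil => simp [prefixChooseSum, Nat.choose_succ_succ]
  | cons s c ih =>
    cases s <;> simp only [prefixChooseSum, ih, Nat.choose_succ_succ x m] <;> ring

theorem prefixChooseSum_zero (x : ℕ) (c : List CodeSymbol) :
    prefixChooseSum 0 x c = c.length + 1 := by
  induction c generalizing x with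
  | nil => simp [prefixChooseSum]
  | cons s c ih => cases s <;> simp only [prefixChooseSum, ih, Nat.choose_zero_right,
      List.length_cons] <;> ring

/-- In a clique, take the vertex added earliest: the others are any m symbols `+` to its left in the
code. Its own symbol plays no role, so the uncoded initial vertex counts like the rest. -/
theorem numCliques_thresholdGraph (c : List CodeSymbol) (m : ℕ) :
    numCliques (thresholdGraph c) (m + 1) = prefixChooseSum m 0 c := by
  induction c generalizing m with
  | nil =>
    rcases m with _ | m
    · rw [numCliques_one, prefixChooseSum_zero, card_thresholdVertex]
    · have : {s : Finset (ThresholdVertex []) |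
          (thresholdGraph []).IsNClique (m + 1 + 1) s} = ∅ := by
        refine Set.eq_empty_of_forall_notMem fun s hs => ?_
        have h1 := hs.card_eq
        obtain ⟨x, -, y, -, hxy⟩ := Finset.one_lt_card.1 (by omega : 1 < s.card)
        exact hxy (Subsingleton.elim (α := Unit) x y)
      simp only [numCliques, this, Set.ncard_empty, prefixChooseSum, Nat.choose_zero_succ]
  | cons s c ih =>
    rcases m with _ | m
    · rw [numCliques_one, prefixChooseSum_zero, card_thresholdVertex]
    · cases s
      · change numCliques (addDominating (thresholdGraph c)) (m + 1 + 1) = _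
        rw [numCliques_addDominating, ih, ih]
        simp only [prefixChooseSum, prefixChooseSum_succ, Nat.choose_zero_succ]
        ring
      · change numCliques (addIsolated (thresholdGraph c)) (m + 2) = _
        rw [numCliques_addIsolated, ih]
        simp only [prefixChooseSum, Nat.choose_zero_succ, zero_add]

/-! ### Compression to threshold graphs -/

/-- The compression of `G` from `u` to `v`: every edge at `u` is moved to `v` where possible. -/
def compressGraph {V : Type*} [DecidableEq V] (G : SimpleGraph V) (u v : V) : SimpleGraph V where
  Adj x y := (G.Adj x y ∧ G.Adj (Equiv.swap u v x) (Equiv.swap u v y)) ∨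
    ((x = v ∨ y = v) ∧ (G.Adj x y ∨ G.Adj (Equiv.swap u v x) (Equiv.swap u v y)))
  symm := ⟨by
    intro x y h
    rwa [G.adj_comm y x, G.adj_comm (Equiv.swap u v y), or_comm (a := y = v)]⟩
  loopless := ⟨by intro x h; simp at h⟩

theorem compressGraph_adj {V : Type*} [DecidableEq V] (G : SimpleGraph V) (u v x y : V) :
    (compressGraph G u v).Adj x y ↔
      (G.Adj x y ∧ G.Adj (Equiv.swap u v x) (Equiv.swap u v y)) ∨
    ((x = v ∨ y = v) ∧ (G.Adj x y ∨ G.Adj (Equiv.swap u v x) (Equiv.swap u v y))) := Iff.rfl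

/-- A clique is lost only if it contains u but not v and its image under the swap of u and v is not
a clique of `G`. Such a clique is replaced by that image, which becomes a clique. The map is
injective because replaced sets are not cliques of `G`, while kept sets are. -/
theorem numCliques_le_compressGraph {V : Type*} [Finite V] [DecidableEq V] (G : SimpleGraph V)
    (u v : V) (t : ℕ) : numCliques G t ≤ numCliques (compressGraph G u v) t := by
  classical
  have mem_swap : ∀ (s : Finset V) (x : V), x ∈ s.map (Equiv.swap u v).toEmbedding ↔
      Equiv.swap u v x ∈ s := fun s x => by rw [Finset.mem_map_equiv, Equiv.symm_swap]
  refine Set.ncard_le_ncard_of_injOn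
    (fun s => if v ∉ s ∧ ¬ G.IsClique (s.map (Equiv.swap u v).toEmbedding : Finset V)
      then s.map (Equiv.swap u v).toEmbedding else s) ?_ ?_ (Set.toFinite _)
  · rintro s ⟨hs, hc⟩
    simp only [Set.mem_ofPred_eq, SimpleGraph.isNClique_iff]
    split_ifs with h
    · refine ⟨?_, by simpa using hc⟩
      intro x hx y hy hxy
      rw [Finset.mem_coe, mem_swap] at hx hy
      have hσ : G.Adj (Equiv.swap u v x) (Equiv.swap u v y) :=
        hs hx hy fun h => hxy ((Equiv.swap u v).injective h)
      rw [compressGraph_adj]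
      by_cases hv : x = v ∨ y = v
      · exact Or.inr ⟨hv, Or.inr hσ⟩
      · push Not at hv
        have hxu : x ≠ u := by rintro rfl; rw [Equiv.swap_apply_left] at hx; exact h.1 hx
        have hyu : y ≠ u := by rintro rfl; rw [Equiv.swap_apply_left] at hy; exact h.1 hy
        have hσ' := hσ
        rw [Equiv.swap_apply_of_ne_of_ne hxu hv.1, Equiv.swap_apply_of_ne_of_ne hyu hv.2] at hσ'
        exact Or.inl ⟨hσ', hσ⟩
    · refine ⟨?_, hc⟩
      intro x hx y hy hxy
      have hA : G.Adj x y := hs hx hy hxy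
      rw [compressGraph_adj]
      by_cases hv : x = v ∨ y = v
      · exact Or.inr ⟨hv, Or.inl hA⟩
      push Not at hv
      refine Or.inl ⟨hA, ?_⟩
      have hne : Equiv.swap u v x ≠ Equiv.swap u v y := fun h => hxy ((Equiv.swap u v).injective h)
      by_cases hvs : v ∈ s
      · refine hs ?_ ?_ hne
        · by_cases hxu : x = u
          · rw [hxu, Equiv.swap_apply_left]; exact hvs
          · rwa [Equiv.swap_apply_of_ne_of_ne hxu hv.1]
        · by_cases hyu : y = u
          · rw [hyu, Equiv.swap_apply_left]; exact hvs
          · rwa [Equiv.swap_apply_of_ne_of_ne hyu hv.2]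
      · have hcl : G.IsClique (s.map (Equiv.swap u v).toEmbedding : Finset V) := by
          by_contra hcl
          exact h ⟨hvs, hcl⟩
        refine hcl ?_ ?_ hne
        · rw [Finset.mem_coe, mem_swap, Equiv.swap_apply_self]; exact hx
        · rw [Finset.mem_coe, mem_swap, Equiv.swap_apply_self]; exact hy
  · rintro s ⟨hs, -⟩ s' ⟨hs', -⟩ h
    dsimp only at h
    split_ifs at h with h1 h2 h2
    · exact Finset.map_injective _ h
    · exact absurd (h ▸ hs') h1.2
    · exact absurd (h ▸ hs) h2.2
    · exact h

/-- De Morgan: pairs containing v but not u carry "or", pairs containing u but not v carry "and",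
and complementation exchanges them. Every other pair is fixed by the swap. -/
theorem compl_compressGraph {V : Type*} [DecidableEq V] (G : SimpleGraph V) (u v : V) :
    (compressGraph G u v)ᶜ = compressGraph Gᶜ v u := by
  ext x y
  have key : (x = u ∨ y = u) → (x = v ∨ y = v) → x ≠ y →
      (G.Adj x y ↔ G.Adj (Equiv.swap u v x) (Equiv.swap u v y)) := by
    rintro (rfl | rfl) (rfl | rfl) h
    · simp
    · simp [G.adj_comm]
    · simp [G.adj_comm]
    · simp
  have key' : ¬ (x = u ∨ y = u) → ¬ (x = v ∨ y = v) →
      (G.Adj x y ↔ G.Adj (Equiv.swap u v x) (Equiv.swap u v y)) := by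
    intro h h'
    push Not at h h'
    rw [Equiv.swap_apply_of_ne_of_ne h.1 h'.1, Equiv.swap_apply_of_ne_of_ne h.2 h'.2]
  simp only [SimpleGraph.compl_adj, compressGraph_adj, Equiv.swap_comm v u, ne_eq,
    EmbeddingLike.apply_eq_iff_eq]
  tauto

theorem numIndepSets_le_compressGraph {V : Type*} [Finite V] [DecidableEq V] (G : SimpleGraph V)
    (u v : V) (t : ℕ) : numIndepSets G t ≤ numIndepSets (compressGraph G u v) t := by
  rw [numIndepSets_eq_numCliques_compl, numIndepSets_eq_numCliques_compl, compl_compressGraph]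
  exact numCliques_le_compressGraph _ _ _ _

/-- Every graph can be replaced by one with at least as many cliques and independent sets of every
size, in which the neighbourhood of `v` contains every other one. -/
theorem exists_forall_neighbors_subset {V : Type*} [Finite V] (G : SimpleGraph V) (v : V) :
    ∃ H : SimpleGraph V, (∀ t, numCliques G t ≤ numCliques H t) ∧
      (∀ t, numIndepSets G t ≤ numIndepSets H t) ∧
      ∀ u w, w ≠ v → H.Adj u w → H.Adj v w := by
  classical
  have := Fintype.ofFinite V
  suffices h : ∀ s : Finset V, v ∉ s → ∃ H : SimpleGraph V,
      (∀ t, numCliques G t ≤ numCliques H t) ∧ (∀ t, numIndepSets G t ≤ numIndepSets H t) ∧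
      ∀ u ∈ s, ∀ w, w ≠ v → H.Adj u w → H.Adj v w by
    obtain ⟨H, h1, h2, h3⟩ := h (Finset.univ.erase v) (by simp)
    refine ⟨H, h1, h2, fun u w hw huw => ?_⟩
    by_cases hu : u = v
    · exact hu ▸ huw
    · exact h3 u (by simpa using hu) w hw huw
  intro s
  induction s using Finset.induction_on with
  | empty => exact fun _ => ⟨G, fun _ => le_rfl, fun _ => le_rfl, by simp⟩
  | insert a s ha ih =>
    intro hv
    rw [Finset.mem_insert, not_or] at hv
    obtain ⟨H, h1, h2, h3⟩ := ih hv.2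
    refine ⟨compressGraph H a v, fun t => (h1 t).trans (numCliques_le_compressGraph _ _ _ _),
      fun t => (h2 t).trans (numIndepSets_le_compressGraph _ _ _ _), fun u hu w hw huw => ?_⟩
    rw [compressGraph_adj] at huw ⊢
    refine Or.inr ⟨Or.inl rfl, ?_⟩
    have huv : u ≠ v := by
      rintro rfl
      rcases Finset.mem_insert.1 hu with h | h
      · exact hv.1 h
      · exact hv.2 h
    -- Away from v compression only deletes edges, and at v it keeps an edge or gains one from a, so
    -- the inclusions already obtained survive.
    have hA : H.Adj u w ∧ H.Adj (Equiv.swap a v u) (Equiv.swap a v w) := by tauto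
    by_cases hua : u = a
    · right
      rw [Equiv.swap_apply_right]
      by_cases hwa : w = a
      · exact absurd (hua.trans hwa.symm) hA.1.ne
      · rw [Equiv.swap_apply_of_ne_of_ne hwa hw, ← hua]
        exact hA.1
    · left
      exact h3 u ((Finset.mem_insert.1 hu).resolve_left hua) w hw hA.1

/-- A graph in which `v` is adjacent to all other vertices is obtained by adding a dominating
vertex. -/
def isoAddDominating {V : Type*} [DecidableEq V] (G : SimpleGraph V) (v : V)
    (h : ∀ w, w ≠ v → G.Adj v w) :
    addDominating (G.comap (Subtype.val : {w // w ≠ v} → V)) ≃g G :=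
  ⟨Equiv.optionSubtypeNe v, by
    rintro (_ | ⟨x, hx⟩) (_ | ⟨y, hy⟩)
    · simp [addDominating]
    · simpa [addDominating] using h y hy
    · simpa [addDominating] using (h x hx).symm
    · simp [addDominating]⟩

/-- A graph in which `v` is not adjacent to any vertex is obtained by adding an isolated
vertex. -/
def isoAddIsolated {V : Type*} [DecidableEq V] (G : SimpleGraph V) (v : V)
    (h : ∀ w, ¬ G.Adj v w) :
    addIsolated (G.comap (Subtype.val : {w // w ≠ v} → V)) ≃g G :=
  ⟨Equiv.optionSubtypeNe v, by
    rintro (_ | ⟨x, hx⟩) (_ | ⟨y, hy⟩)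
    · simp [addIsolated]
    · simpa [addIsolated] using h y
    · simpa [addIsolated, G.adj_comm] using h x
    · simp [addIsolated]⟩

theorem numCliques_addDominating_mono {V W : Type*} [Finite V] [Finite W] {G : SimpleGraph V}
    {H : SimpleGraph W} (h : ∀ t, numCliques G t ≤ numCliques H t) (t : ℕ) :
    numCliques (addDominating G) t ≤ numCliques (addDominating H) t := by
  rcases t with _ | t
  · rw [numCliques_zero, numCliques_zero]
  · rw [numCliques_addDominating, numCliques_addDominating]
    exact add_le_add (h _) (h _)

theorem numCliques_addIsolated_mono {V W : Type*} [Finite V] [Finite W] {G : SimpleGraph V}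
    {H : SimpleGraph W} (h : ∀ t, numCliques G t ≤ numCliques H t) (t : ℕ) :
    numCliques (addIsolated G) t ≤ numCliques (addIsolated H) t := by
  rcases t with _ | _ | t
  · rw [numCliques_zero, numCliques_zero]
  -- An isolated vertex is a clique of size 1, so here the hypothesis is used as a comparison of
  -- vertex numbers.
  · have := h 1
    rw [numCliques_one, numCliques_one] at this ⊢
    rw [Finite.card_option, Finite.card_option]
    omega
  · rw [numCliques_addIsolated, numCliques_addIsolated]
    exact h _

/-- Every graph is dominated by a threshold graph on the same number of vertices. -/
theorem exists_thresholdGraph_dominating {V : Type*} [Finite V] (G : SimpleGraph V) (n : ℕ)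
    (hn : Nat.card V = n + 1) :
    ∃ c : List CodeSymbol, c.length = n ∧
      (∀ t, numCliques G t ≤ numCliques (thresholdGraph c) t) ∧
      ∀ t, numIndepSets G t ≤ numIndepSets (thresholdGraph c) t := by
  classical
  induction n generalizing V with
  | zero =>
    have : Subsingleton V := (Nat.card_eq_one_iff_unique.1 hn).1
    obtain ⟨v⟩ := (Nat.card_eq_one_iff_unique.1 hn).2
    have e : G ≃g thresholdGraph [] :=
      ⟨(⟨fun _ => (), fun _ => v, fun x => Subsingleton.elim _ x, fun _ => rfl⟩ : V ≃ Unit), by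
        intro x y
        obtain rfl : x = y := Subsingleton.elim x y
        exact iff_of_false (SimpleGraph.irrefl _) (SimpleGraph.irrefl _)⟩
    exact ⟨[], rfl, fun t => (numCliques_congr e t).le, fun t => (numIndepSets_congr e t).le⟩
  | succ n ih =>
    have hne : Nonempty V := (Nat.card_pos_iff.1 (by omega)).1
    obtain ⟨v⟩ := hne
    obtain ⟨H, h1, h2, h3⟩ := exists_forall_neighbors_subset G v
    have hcard : ∀ w : V, Nat.card {x // x ≠ w} = n + 1 := by
      intro w
      have h := Nat.card_congr (Equiv.optionSubtypeNe w)
      rw [Finite.card_option] at h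
      omega
    -- Either v is dominating, or some w is not adjacent to v; then w is isolated, since a neighbour
    -- of w would pass w on to v.
    by_cases hv : ∀ w, w ≠ v → H.Adj v w
    · obtain ⟨c, hc, hk, hi⟩ := ih (H.comap (Subtype.val : {w // w ≠ v} → V)) (hcard v)
      have e := isoAddDominating H v hv
      refine ⟨CodeSymbol.plus :: c, by simp [hc], fun t => ?_, fun t => ?_⟩
      · refine (h1 t).trans ?_
        rw [← numCliques_congr e]
        exact numCliques_addDominating_mono hk t
      · refine (h2 t).trans ?_
        rw [← numIndepSets_congr e, numIndepSets_eq_numCliques_compl, compl_addDominating]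
        change _ ≤ numIndepSets (addDominating (thresholdGraph c)) t
        rw [numIndepSets_eq_numCliques_compl, compl_addDominating]
        refine numCliques_addIsolated_mono (fun t => ?_) t
        rw [← numIndepSets_eq_numCliques_compl, ← numIndepSets_eq_numCliques_compl]
        exact hi t
    · push Not at hv
      obtain ⟨w, hw, hvw⟩ := hv
      have hiso : ∀ x, ¬ H.Adj w x := fun x hx => hvw (h3 x w hw hx.symm)
      obtain ⟨c, hc, hk, hi⟩ := ih (H.comap (Subtype.val : {x // x ≠ w} → V)) (hcard w)
      have e := isoAddIsolated H w hiso
      refine ⟨CodeSymbol.minus :: c, by simp [hc], fun t => ?_, fun t => ?_⟩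
      · refine (h1 t).trans ?_
        rw [← numCliques_congr e]
        exact numCliques_addIsolated_mono hk t
      · refine (h2 t).trans ?_
        rw [← numIndepSets_congr e, numIndepSets_eq_numCliques_compl, compl_addIsolated]
        change _ ≤ numIndepSets (addIsolated (thresholdGraph c)) t
        rw [numIndepSets_eq_numCliques_compl, compl_addIsolated]
        refine numCliques_addDominating_mono (fun t => ?_) t
        rw [← numIndepSets_eq_numCliques_compl, ← numIndepSets_eq_numCliques_compl]
        exact hi t

/-! ### The trade-off between the two power sums along a lattice path -/

theorem pow_succ_add_le_add_pow (m : ℕ) {x c : ℝ} (hx : 0 ≤ x) (hc : 0 ≤ c) :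
    x ^ (m + 1) + (m + 1) * x ^ m * c ≤ (x + c) ^ (m + 1) := by
  induction m with
  | zero => simp
  | succ m ih =>
    calc x ^ (m + 1 + 1) + ((m + 1 : ℕ) + 1) * x ^ (m + 1) * c
        ≤ (x ^ (m + 1) + (m + 1) * x ^ m * c) * (x + c) := by
          have h : 0 ≤ (m + 1) * x ^ m * c * c := by positivity
          have e : (x ^ (m + 1) + (m + 1) * x ^ m * c) * (x + c) =
            x ^ (m + 1 + 1) + ((m + 1 : ℕ) + 1) * x ^ (m + 1) * c + (m + 1) * x ^ m * c * c := by
            push_cast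
            ring
          linarith
      _ ≤ (x + c) ^ (m + 1) * (x + c) := by gcongr
      _ = (x + c) ^ (m + 1 + 1) := by ring

theorem concaveOn_mul_one_sub_pow (m : ℕ) :
    ConcaveOn ℝ (Set.Icc 0 1) fun z : ℝ => z * (1 - z ^ m) := by
  have h1 : ConvexOn ℝ (Set.Icc (0 : ℝ) 1) fun z : ℝ => z ^ (m + 1) :=
    (convexOn_pow (m + 1)).subset (fun z hz => hz.1) (convex_Icc 0 1)
  have h2 : ConcaveOn ℝ (Set.Icc (0 : ℝ) 1) fun z : ℝ => z := concaveOn_id (convex_Icc 0 1)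
  refine (h2.sub h1).congr fun z _ => ?_
  change z - z ^ (m + 1) = _
  ring

/-- Let D be the right side minus the left. As D(0) < 0 ≤ D(z₁), D(z₂) < 0 and D(1) = 0, a failure
would make D' positive, negative, positive at three successive points. But D' is an increasing
function of z (1 - z^m), which is concave and so cannot dip in the middle. -/
theorem mul_one_sub_pow_pow_le_one_sub {m : ℕ} (hm : 2 ≤ m) {κ z₁ z₂ : ℝ} (hκ : 1 < κ)
    (h0 : 0 ≤ z₁) (h12 : z₁ ≤ z₂) (h2 : z₂ ≤ 1) (h : κ * (1 - z₁ ^ m) ^ m ≤ 1 - z₁) :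
    κ * (1 - z₂ ^ m) ^ m ≤ 1 - z₂ := by
  by_contra! hlt
  set D : ℝ → ℝ := fun z => 1 - z - κ * (1 - z ^ m) ^ m with hD
  set D' : ℝ → ℝ := fun z => -1 + κ * m ^ 2 * (z * (1 - z ^ m)) ^ (m - 1) with hD'
  have hderiv : ∀ z, HasDerivAt D (D' z) z := by
    intro z
    have h1 := ((hasDerivAt_id z).const_sub 1).sub
      ((((hasDerivAt_pow m z).const_sub 1).pow m).const_mul κ)
    refine h1.congr_deriv ?_
    simp only [hD', mul_pow]
    ring
  have hcont : ∀ p q, ContinuousOn D (Set.Icc p q) := fun p q z _ =>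
    (hderiv z).continuousAt.continuousWithinAt
  have hm0 : m ≠ 0 := by omega
  have hD0 : D 0 < 0 := by simp [hD, hm0]; linarith
  have hD1 : D 1 = 0 := by simp [hD, hm0]
  have hDz1 : 0 ≤ D z₁ := by simp only [hD]; linarith
  have hDz2 : D z₂ < 0 := by simp only [hD]; linarith
  have p1 : 0 < z₁ := lt_of_le_of_ne h0 (by rintro rfl; linarith)
  have p2 : z₁ < z₂ := lt_of_le_of_ne h12 (by rintro rfl; linarith)
  have p3 : z₂ < 1 := lt_of_le_of_ne h2 (by rintro rfl; linarith)
  obtain ⟨ξ₁, ⟨hξ₁, hξ₁'⟩, e1⟩ := exists_hasDerivAt_eq_slope D D' p1 (hcont _ _) fun z _ => hderiv z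
  obtain ⟨ξ₂, ⟨hξ₂, hξ₂'⟩, e2⟩ := exists_hasDerivAt_eq_slope D D' p2 (hcont _ _) fun z _ => hderiv z
  obtain ⟨ξ₃, ⟨hξ₃, hξ₃'⟩, e3⟩ := exists_hasDerivAt_eq_slope D D' p3 (hcont _ _) fun z _ => hderiv z
  have s1 : 0 < D' ξ₁ := by rw [e1]; apply div_pos <;> linarith
  have s2 : D' ξ₂ < 0 := by rw [e2]; apply div_neg_of_neg_of_pos <;> linarith
  have s3 : 0 < D' ξ₃ := by rw [e3]; apply div_pos <;> linarith
  have hmin := (concaveOn_mul_one_sub_pow m).min_le_of_mem_Icc (x := ξ₁) (y := ξ₃) (z := ξ₂)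
    ⟨by linarith, by linarith⟩ ⟨by linarith, by linarith⟩ ⟨by linarith, by linarith⟩
  have nonneg : ∀ ξ : ℝ, 0 ≤ ξ → ξ ≤ 1 → 0 ≤ ξ * (1 - ξ ^ m) := fun ξ h h' =>
    mul_nonneg h (sub_nonneg.2 (pow_le_one₀ h h'))
  have mono : ∀ ξ : ℝ, 0 ≤ ξ → ξ ≤ 1 → ξ * (1 - ξ ^ m) ≤ ξ₂ * (1 - ξ₂ ^ m) → D' ξ ≤ D' ξ₂ := by
    intro ξ h h' hle
    have := nonneg ξ h h'
    simp only [hD']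
    gcongr
  rcases min_le_iff.1 hmin with h | h
  · linarith [mono ξ₁ (by linarith) (by linarith) h]
  · linarith [mono ξ₃ (by linarith) (by linarith) h]

/-- With z^m = 1 - ρu and κ = v / u^m > 1 the claim reads κ (1 - z^m)^m ≤ 1 - z. The hypothesis is
the case ρ = 1, and decreasing ρ increases z. -/
theorem one_sub_mul_le_one_sub_pow_mul_pow {m : ℕ} (hm : 2 ≤ m) {u v ρ : ℝ} (hu0 : 0 ≤ u)
    (hu1 : u ≤ 1) (hv1 : v ≤ 1) (huv : u ^ m < v) (h : 1 - u ≤ (1 - v) ^ m)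
    (hρ0 : 0 ≤ ρ) (hρ1 : ρ ≤ 1) : 1 - ρ * u ≤ (1 - ρ ^ m * v) ^ m := by
  have hm0 : m ≠ 0 := by omega
  have hv0 : 0 < v := lt_of_le_of_lt (by positivity) huv
  have hu : 0 < u := by
    refine lt_of_le_of_ne hu0 ?_
    rintro rfl
    have := pow_lt_one₀ (by linarith : 0 ≤ 1 - v) (by linarith) hm0
    linarith
  have hρu : ρ * u ≤ u := by nlinarith
  have root : ∀ w : ℝ, w ≤ 1 → ∃ z : ℝ, 0 ≤ z ∧ z ^ m = 1 - w := fun w hw =>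
    ⟨(1 - w) ^ ((m : ℝ)⁻¹), Real.rpow_nonneg (by linarith) _,
      Real.rpow_inv_natCast_pow (by linarith) hm0⟩
  obtain ⟨z₁, hz₁, e₁⟩ := root u hu1
  obtain ⟨z₂, hz₂, e₂⟩ := root (ρ * u) (by linarith)
  have hz₁v : z₁ ≤ 1 - v := by
    rw [← e₁] at h
    exact le_of_pow_le_pow_left₀ hm0 (by linarith) h
  have hz₁₂ : z₁ ≤ z₂ := by
    refine le_of_pow_le_pow_left₀ hm0 hz₂ ?_
    rw [e₁, e₂]
    linarith
  have hz₂1 : z₂ ≤ 1 := by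
    refine le_of_pow_le_pow_left₀ hm0 zero_le_one ?_
    rw [e₂, one_pow]
    linarith [mul_nonneg hρ0 hu0]
  have hum : 0 < u ^ m := by positivity
  have key := mul_one_sub_pow_pow_le_one_sub hm (κ := v / u ^ m) ((one_lt_div hum).2 huv) hz₁
    hz₁₂ hz₂1 (by
      rw [e₁, sub_sub_cancel, div_mul_cancel₀ _ hum.ne']
      linarith)
  rw [e₂, sub_sub_cancel, mul_pow, mul_comm (ρ ^ m), ← mul_assoc, div_mul_cancel₀ _ hum.ne'] at key
  rw [← e₂]
  gcongr
  linarith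

/-- The constraint satisfied by the normalized areas `A` and `B` that a monotone path in the unit
square cuts out. -/
def AreaBound (m : ℕ) (A B : ℝ) : Prop :=
  A ≤ (1 - B) ^ m ∨ B ≤ (1 - A) ^ m

/-- The first alternative scales exactly by ρ^m. The second is needed only when the first fails,
which is the strict inequality κ > 1 of the preceding lemmas. -/
theorem AreaBound.step {m : ℕ} (hm : 2 ≤ m) {A B ρ : ℝ} (hA1 : A ≤ 1) (hB0 : 0 ≤ B)
    (hB1 : B ≤ 1) (h : AreaBound m A B) (hρ0 : 0 ≤ ρ) (hρ1 : ρ ≤ 1) :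
    AreaBound m (ρ ^ m * A) (1 - ρ * (1 - B)) := by
  by_cases h' : A ≤ (1 - B) ^ m
  · left
    rw [sub_sub_cancel, mul_pow]
    gcongr
  · right
    refine one_sub_mul_le_one_sub_pow_mul_pow hm (by linarith) (by linarith) hA1 (not_le.1 h') ?_
      hρ0 hρ1
    linarith [h.resolve_left h']

/-- The bounds on the two power sums `K` and `I` along a monotone lattice path from the origin to
`(x, y)`. -/
def PathBound (m : ℕ) (x y K I : ℝ) : Prop :=
  ∃ A B : ℝ, 0 ≤ A ∧ A ≤ 1 ∧ 0 ≤ B ∧ B ≤ 1 ∧ AreaBound m A B ∧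
    (m + 1) * K ≤ x ^ m * (x + (m + 1) * y * A) ∧ (m + 1) * I ≤ y ^ m * (y + (m + 1) * x * B)

theorem PathBound.symm {m : ℕ} {x y K I : ℝ} (h : PathBound m x y K I) : PathBound m y x I K := by
  obtain ⟨A, B, hA0, hA1, hB0, hB1, hAB, hK, hI⟩ := h
  exact ⟨B, A, hB0, hB1, hA0, hA1, hAB.symm, hI, hK⟩

/-- A horizontal step rescales the means: with ρ = x / (x + 1), A becomes ρ^m A, and B is averaged
with one new value 1, becoming (xB + 1) / (x + 1) = 1 - ρ (1 - B). -/
theorem PathBound.step {m : ℕ} (hm : 2 ≤ m) {x y K I K' I' : ℝ} (hx : 0 ≤ x)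
    (h : PathBound m x y K I) (hK' : K' ≤ K + x ^ m) (hI' : I' ≤ I + y ^ m) :
    PathBound m (x + 1) y K' I' := by
  obtain ⟨A, B, hA0, hA1, hB0, hB1, hAB, hK, hI⟩ := h
  have hx1 : 0 < x + 1 := by linarith
  have hρ0 : 0 ≤ x / (x + 1) := by positivity
  have hρ1 : x / (x + 1) ≤ 1 := (div_le_one hx1).2 (by linarith)
  have hρm := pow_le_one₀ (n := m) hρ0 hρ1
  refine ⟨(x / (x + 1)) ^ m * A, 1 - x / (x + 1) * (1 - B), by positivity, by nlinarith,
    by nlinarith, by nlinarith, hAB.step hm hA1 hB0 hB1 hρ0 hρ1, ?_, ?_⟩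
  · have e : (x + 1) ^ m * (x + 1 + (m + 1) * y * ((x / (x + 1)) ^ m * A)) =
        (x + 1) ^ (m + 1) + (m + 1) * y * A * x ^ m := by
      rw [div_pow]
      field_simp
      ring
    rw [e]
    have := pow_succ_add_le_add_pow m hx zero_le_one
    calc (m + 1) * K' ≤ (m + 1) * (K + x ^ m) := by gcongr
      _ = (m + 1) * K + (m + 1) * x ^ m := by ring
      _ ≤ x ^ m * (x + (m + 1) * y * A) + (m + 1) * x ^ m := by gcongr
      _ = (x ^ (m + 1) + (m + 1) * x ^ m * 1) + (m + 1) * y * A * x ^ m := by ring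
      _ ≤ _ := by gcongr
  · have e : (m + 1) * (x + 1) * (1 - x / (x + 1) * (1 - B)) = (m + 1) * (x * B + 1) := by
      field_simp
      ring
    rw [e]
    calc (m + 1) * I' ≤ (m + 1) * (I + y ^ m) := by gcongr
      _ = (m + 1) * I + (m + 1) * y ^ m := by ring
      _ ≤ y ^ m * (y + (m + 1) * x * B) + (m + 1) * y ^ m := by gcongr
      _ = _ := by ring

theorem factorial_mul_choose_le_pow (m x : ℕ) : (m.factorial : ℝ) * (x.choose m : ℝ) ≤ x ^ m := by
  rw [← Nat.cast_mul, ← Nat.descFactorial_eq_factorial_mul_choose]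
  exact_mod_cast Nat.descFactorial_le_pow x m

theorem exists_pathBound_prefixChooseSum {m : ℕ} (hm : 2 ≤ m) (c : List CodeSymbol) (x y : ℕ)
    {K I : ℝ} (h : PathBound m x y K I) :
    ∃ X Y : ℝ, 0 ≤ X ∧ 0 ≤ Y ∧ X + Y = x + y + c.length + 1 ∧
      PathBound m X Y (K + m.factorial * prefixChooseSum m x c)
        (I + m.factorial * prefixChooseSum m y (c.map CodeSymbol.flip)) := by
  have hx := factorial_mul_choose_le_pow m x
  have hy := factorial_mul_choose_le_pow m y
  induction c generalizing x y K I with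
  | nil =>
    -- The initial vertex is counted as a final horizontal step, so the path has as many steps as
    -- the graph has vertices.
    refine ⟨x + 1, y, by positivity, by positivity, by simp; ring,
      h.step hm (Nat.cast_nonneg x) ?_ ?_⟩
    · simpa [prefixChooseSum] using hx
    · simpa [prefixChooseSum] using hy
  | cons s c ih =>
    cases s
    · have h' : PathBound m ((x + 1 : ℕ) : ℝ) y (K + m.factorial * x.choose m)
          (I + m.factorial * y.choose m) := by
        push_cast
        exact h.step hm (Nat.cast_nonneg x) (by linarith) (by linarith)
      obtain ⟨X, Y, hX, hY, hXY, hP⟩ := ih (x + 1) y h' (factorial_mul_choose_le_pow _ _) hy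
      refine ⟨X, Y, hX, hY, by rw [hXY]; push_cast [List.length_cons]; ring, ?_⟩
      convert hP using 1 <;>
        simp only [prefixChooseSum, List.map_cons, CodeSymbol.flip, Nat.cast_add] <;> ring
    · have h' : PathBound m x ((y + 1 : ℕ) : ℝ) (K + m.factorial * x.choose m)
          (I + m.factorial * y.choose m) := by
        push_cast
        exact (h.symm.step hm (Nat.cast_nonneg y) (by linarith) (by linarith)).symm
      obtain ⟨X, Y, hX, hY, hXY, hP⟩ := ih x (y + 1) h' hx (factorial_mul_choose_le_pow _ _)
      refine ⟨X, Y, hX, hY, by rw [hXY]; push_cast [List.length_cons]; ring, ?_⟩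
      convert hP using 1 <;>
        simp only [prefixChooseSum, List.map_cons, CodeSymbol.flip, Nat.cast_add] <;> ring

/-! ### The maximum of `fT` -/

theorem fT_succ (m : ℕ) (x : ℝ) : fT (m + 1) x = x ^ (m + 1) * (1 - x) ^ m * (1 + m * x) := by
  simp [fT]

theorem muT_mem_and_quadratic {m : ℕ} (hm : 2 ≤ m) :
    0 < muT (m + 1) ∧ muT (m + 1) < 1 ∧
      2 * m * muT (m + 1) ^ 2 - (m - 1) * muT (m + 1) - 1 = 0 := by
  have hm' : (2 : ℝ) ≤ m := by exact_mod_cast hm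
  have hμ : muT (m + 1) = (m - 1 + Real.sqrt (m ^ 2 + 6 * m + 1)) / (4 * m) := by
    have e : ((m + 1 : ℕ) : ℝ) ^ 2 + 4 * ((m + 1 : ℕ) : ℝ) - 4 = m ^ 2 + 6 * m + 1 := by
      push_cast
      ring
    rw [muT, e]
    push_cast
    have h1 : (m : ℝ) + 1 - 1 = m := by ring
    rw [h1]
    field_simp
    ring
  have hs : Real.sqrt (m ^ 2 + 6 * m + 1) ^ 2 = (m : ℝ) ^ 2 + 6 * m + 1 :=
    Real.sq_sqrt (by positivity)
  have hs0 : 0 ≤ Real.sqrt (m ^ 2 + 6 * m + 1) := Real.sqrt_nonneg _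
  have hs1 : Real.sqrt (m ^ 2 + 6 * m + 1) < 3 * m + 1 := by
    rw [Real.sqrt_lt' (by positivity)]
    nlinarith
  rw [hμ]
  refine ⟨div_pos (by linarith) (by linarith), (div_lt_one (by linarith)).2 (by linarith), ?_⟩
  generalize Real.sqrt (m ^ 2 + 6 * m + 1) = s at *
  field_simp
  linear_combination 2 * hs

theorem hasDerivAt_fT_succ {m : ℕ} (hm : 2 ≤ m) (x : ℝ) :
    HasDerivAt (fT (m + 1))
      ((m + 1) * (x ^ m * (1 - x) ^ (m - 1) * (1 + (m - 1) * x - 2 * m * x ^ 2))) x := by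
  obtain ⟨k, rfl⟩ : ∃ k, m = k + 1 := ⟨m - 1, by omega⟩
  have h : HasDerivAt (fun x : ℝ => x ^ (k + 1 + 1) * (1 - x) ^ (k + 1) * (1 + (k + 1 : ℕ) * x)) _ x :=
    ((hasDerivAt_pow (k + 1 + 1) x).mul (((hasDerivAt_id x).const_sub 1).pow (k + 1))).mul
      (((hasDerivAt_id x).const_mul ((k + 1 : ℕ) : ℝ)).const_add 1)
  rw [show fT (k + 1 + 1) = fun x : ℝ => x ^ (k + 1 + 1) * (1 - x) ^ (k + 1) * (1 + (k + 1 : ℕ) * x)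
    from funext (fT_succ (k + 1))]
  convert h using 1
  simp only [id, Pi.mul_apply, Pi.pow_apply, Nat.add_sub_cancel]
  push_cast
  ring

theorem fT_le_fT_muT {m : ℕ} (hm : 2 ≤ m) {x : ℝ} (hx0 : 0 ≤ x) (hx1 : x ≤ 1) :
    fT (m + 1) x ≤ fT (m + 1) (muT (m + 1)) := by
  obtain ⟨hμ0, hμ1, hq⟩ := muT_mem_and_quadratic hm
  set μ := muT (m + 1)
  have hm' : (2 : ℝ) ≤ m := by exact_mod_cast hm
  -- The quadratic factor of the derivative has roots μ and -1 / (2mμ); multiplication by μ clears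
  -- the denominator.
  have hquad : ∀ z : ℝ, μ * (1 + (m - 1) * z - 2 * m * z ^ 2) = (μ - z) * (2 * m * μ * z + 1) := by
    intro z
    linear_combination (-z) * hq
  have hcont : ∀ s, ContinuousOn (fT (m + 1)) s := fun s z _ =>
    (hasDerivAt_fT_succ hm z).continuousAt.continuousWithinAt
  rcases le_total x μ with h | h
  · refine monotoneOn_of_deriv_nonneg (convex_Icc 0 μ) (hcont _)
      (fun z _ => (hasDerivAt_fT_succ hm z).differentiableAt.differentiableWithinAt) ?_
      ⟨hx0, h⟩ ⟨hμ0.le, le_rfl⟩ h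
    intro z hz
    rw [interior_Icc] at hz
    rw [(hasDerivAt_fT_succ hm z).deriv]
    have h1 : 0 ≤ 1 - z := by linarith [hz.2]
    have h0 : 0 ≤ z := hz.1.le
    have h2 : 0 ≤ μ * (1 + (m - 1) * z - 2 * m * z ^ 2) := by
      rw [hquad]
      exact mul_nonneg (by linarith [hz.2]) (by positivity)
    have h3 := nonneg_of_mul_nonneg_right h2 hμ0
    positivity
  · refine antitoneOn_of_deriv_nonpos (convex_Icc μ 1) (hcont _)
      (fun z _ => (hasDerivAt_fT_succ hm z).differentiableAt.differentiableWithinAt) ?_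
      ⟨le_rfl, hμ1.le⟩ ⟨h, hx1⟩ h
    intro z hz
    rw [interior_Icc] at hz
    rw [(hasDerivAt_fT_succ hm z).deriv]
    have h1 : 0 ≤ 1 - z := by linarith [hz.2]
    have h0 : 0 ≤ z := by linarith [hz.1]
    have h2 : 0 ≤ μ * -(1 + (m - 1) * z - 2 * m * z ^ 2) := by
      rw [mul_neg, hquad, ← neg_mul]
      exact mul_nonneg (by linarith [hz.1]) (by positivity)
    have h3 := nonneg_of_mul_nonneg_right h2 hμ0
    have h4 : 0 ≤ ((m : ℝ) + 1) * (z ^ m * (1 - z) ^ (m - 1) *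
      -(1 + (m - 1) * z - 2 * m * z ^ 2)) := by positivity
    linarith

/-! ### Three-block paths -/

/-- By homogeneity only r = c / a matters, and the inequality becomes (1 + r)^m ≤ 1 + m² r. The left
side is convex and both sides agree at r = 0, so validity passes to smaller r. In `three_block_le`
this shows that the derivative changes sign at most once, from negative to positive. -/
theorem add_pow_le_of_lt_of_le {m : ℕ} (hm : 2 ≤ m) {a₁ c₁ a₂ c₂ : ℝ} (ha₁ : 0 ≤ a₁)
    (ha : a₁ ≤ a₂) (hc₂ : 0 ≤ c₂) (hc : c₂ ≤ c₁)
    (h : (a₁ + c₁) ^ m < a₁ ^ m + m ^ 2 * a₁ ^ (m - 1) * c₁) :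
    (a₂ + c₂) ^ m ≤ a₂ ^ m + m ^ 2 * a₂ ^ (m - 1) * c₂ := by
  have hm0 : m ≠ 0 := by omega
  have hm1 : m - 1 ≠ 0 := by omega
  have hc₁ : 0 ≤ c₁ := hc₂.trans hc
  have ha₁' : 0 < a₁ := by
    refine lt_of_le_of_ne ha₁ ?_
    rintro rfl
    rw [zero_pow hm0, zero_pow hm1, zero_add, mul_zero, zero_mul, zero_add] at h
    exact absurd h (not_lt.2 (by positivity))
  have ha₂ : 0 < a₂ := ha₁'.trans_le ha
  have scale : ∀ a c : ℝ, 0 < a → (a + c) ^ m = a ^ m * (1 + c / a) ^ m ∧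
      a ^ m + m ^ 2 * a ^ (m - 1) * c = a ^ m * (1 + m ^ 2 * (c / a)) := by
    intro a c ha
    obtain ⟨k, rfl⟩ : ∃ k, m = k + 1 := ⟨m - 1, by omega⟩
    constructor
    · rw [← mul_pow]
      congr 1
      field_simp
    · rw [Nat.add_sub_cancel]
      field_simp
      ring
  rw [(scale a₁ c₁ ha₁').1, (scale a₁ c₁ ha₁').2] at h
  rw [(scale a₂ c₂ ha₂).1, (scale a₂ c₂ ha₂).2]
  have h1 := lt_of_mul_lt_mul_left h (by positivity)
  have hr : c₂ / a₂ ≤ c₁ / a₁ := by gcongr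
  have hr2 : 0 ≤ c₂ / a₂ := by positivity
  generalize c₁ / a₁ = r₁ at *
  generalize c₂ / a₂ = r₂ at *
  have hr1 : 0 < r₁ := by
    refine lt_of_le_of_ne (hr2.trans hr) ?_
    rintro rfl
    simp at h1
  have hθ : r₂ / r₁ ≤ 1 := (div_le_one hr1).2 hr
  obtain ⟨-, hconv⟩ := convexOn_pow (𝕜 := ℝ) m
  replace hconv := @hconv 1 (by simp) (1 + r₁) (by simp; linarith) (1 - r₂ / r₁) (r₂ / r₁)
    (by linarith) (by positivity) (by ring)
  simp only [smul_eq_mul, one_pow, mul_one] at hconv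
  have e1 : 1 - r₂ / r₁ + r₂ / r₁ * (1 + r₁) = 1 + r₂ := by field_simp; ring
  rw [e1] at hconv
  gcongr
  calc (1 + r₂) ^ m ≤ 1 - r₂ / r₁ + r₂ / r₁ * (1 + r₁) ^ m := hconv
    _ ≤ 1 - r₂ / r₁ + r₂ / r₁ * (1 + m ^ 2 * r₁) := by gcongr
    _ = 1 + m ^ 2 * r₂ := by field_simp; ring

/-- The product of the clique and independent set densities of the threshold graphs with three
blocks `+`, `-`, `+` is at most the maximum of `fT`. -/
theorem three_block_le {m : ℕ} (hm : 2 ≤ m) {a b c : ℝ} (ha : 0 ≤ a) (hb : 0 ≤ b) (hc : 0 ≤ c)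
    (habc : a + b + c = 1) :
    ((a + c) ^ (m + 1) + (m + 1) * a ^ m * b) * (b ^ m * (b + (m + 1) * c)) ≤
      fT (m + 1) (muT (m + 1)) := by
  have hm0 : m ≠ 0 := by omega
  have hm' : (2 : ℝ) ≤ m := by exact_mod_cast hm
  rcases hb.eq_or_lt with rfl | hb
  · have h0 := fT_le_fT_muT hm (x := 0) le_rfl zero_le_one
    rw [fT_succ, zero_pow (by omega), zero_mul, zero_mul] at h0
    rw [zero_pow hm0, zero_mul, mul_zero]
    exact h0
  set I := b ^ m * (b + (m + 1) * c) with hI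
  have hI0 : 0 < I := by positivity
  -- along the level set of `I`, the blocks `a` and `c` are functions of the block `s = b`
  set C : ℝ → ℝ := fun s => (I / s ^ m - s) / (m + 1) with hC
  set A : ℝ → ℝ := fun s => 1 - s - C s with hA
  set F : ℝ → ℝ := fun s => (1 - s) ^ (m + 1) + (m + 1) * A s ^ m * s with hF
  have hCb : C b = c := by
    simp only [hC, hI]
    field_simp
    ring
  have hAb : A b = a := by
    simp only [hA, hCb]
    linarith
  have hFb : F b = (a + c) ^ (m + 1) + (m + 1) * a ^ m * b := by
    simp only [hF, hAb]
    rw [show 1 - b = a + c by linarith]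
  have hIC : ∀ s, 0 < s → s ^ m * (s + (m + 1) * C s) = I := by
    intro s hs
    simp only [hC]
    field_simp
    ring
  have hCderiv : ∀ s, 0 < s → HasDerivAt C (-1 - m * C s / s) s := by
    intro s hs
    have h := (((hasDerivAt_const s I).div (hasDerivAt_pow m s) (by positivity)).sub
      (hasDerivAt_id s)).div_const ((m : ℝ) + 1)
    refine h.congr_deriv ?_
    obtain ⟨k, rfl⟩ : ∃ k, m = k + 1 := ⟨m - 1, by omega⟩
    simp only [hC, Nat.add_sub_cancel]
    push_cast
    field_simp
    ring
  have hAderiv : ∀ s, 0 < s → HasDerivAt A (m * C s / s) s := by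
    intro s hs
    exact (((hasDerivAt_id s).const_sub 1).sub (hCderiv s hs)).congr_deriv (by ring)
  have hFderiv : ∀ s, 0 < s → HasDerivAt F ((m + 1) *
      (A s ^ m + m ^ 2 * A s ^ (m - 1) * C s - (A s + C s) ^ m)) s := by
    intro s hs
    have h := (((hasDerivAt_id s).const_sub 1).pow (m + 1)).add
      ((((hAderiv s hs).pow m).const_mul ((m : ℝ) + 1)).mul (hasDerivAt_id s))
    refine h.congr_deriv ?_
    simp only [id, Pi.pow_apply, Nat.add_sub_cancel, show A s + C s = 1 - s by simp [hA]]
    push_cast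
    field_simp
    ring
  -- the right end point, where the block `c` vanishes
  obtain ⟨α, hα0, hαI⟩ : ∃ α : ℝ, 0 ≤ α ∧ α ^ (m + 1) = I :=
    ⟨I ^ (((m + 1 : ℕ) : ℝ)⁻¹), Real.rpow_nonneg hI0.le _,
      Real.rpow_inv_natCast_pow hI0.le (by omega)⟩
  have hbα : b ≤ α := by
    refine le_of_pow_le_pow_left₀ (by omega : m + 1 ≠ 0) hα0 ?_
    rw [hαI, hI, pow_succ]
    gcongr
    have : 0 ≤ (m + 1) * c := by positivity
    linarith
  have hα1 : α ≤ 1 := by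
    refine le_of_pow_le_pow_left₀ (by omega : m + 1 ≠ 0) zero_le_one ?_
    rw [hαI, one_pow]
    calc I = b ^ (m + 1) + (m + 1) * b ^ m * c := by rw [hI]; ring
      _ ≤ (b + c) ^ (m + 1) := pow_succ_add_le_add_pow m hb.le hc
      _ ≤ 1 := pow_le_one₀ (by positivity) (by linarith)
  have hα0' : 0 < α := hb.trans_le hbα
  have hCα : C α = 0 := by
    simp only [hC]
    rw [← hαI, pow_succ]
    field_simp
    ring
  have hC0 : ∀ s, 0 < s → s ≤ α → 0 ≤ C s := by
    intro s hs hsα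
    simp only [hC]
    refine div_nonneg ?_ (by positivity)
    rw [sub_nonneg, le_div_iff₀ (by positivity), ← hαI, mul_comm, ← pow_succ]
    gcongr
  -- the left end point, where the block `a` vanishes
  have hIb : I / (m + 1) ≤ b := by
    rw [div_le_iff₀ (by positivity), hI]
    have h1 : b ^ m ≤ b := by
      calc b ^ m ≤ b ^ 1 := pow_le_pow_of_le_one hb.le (by linarith) (by omega)
        _ = b := pow_one b
    have h2 : b + (m + 1) * c ≤ m + 1 := by nlinarith
    gcongr
  obtain ⟨β, ⟨hβ1, hβb⟩, hAβ⟩ : ∃ β ∈ Set.Icc (I / (m + 1)) b, A β = 0 := by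
    refine intermediate_value_Icc hIb (fun s hs => (hAderiv s ?_).continuousAt.continuousWithinAt)
      ⟨?_, ?_⟩
    · exact lt_of_lt_of_le (by positivity) hs.1
    · have hδ0 : 0 < I / (m + 1) := by positivity
      -- At δ = I / (m + 1) ≤ 1, the bound δ^m ≤ δ gives C δ ≥ 1 - δ / (m + 1), hence A δ ≤ 0.
      have hδ : 1 ≤ I / (I / (m + 1)) ^ m / (m + 1) := by
        rw [div_right_comm, le_div_iff₀ (by positivity), one_mul]
        calc (I / (m + 1)) ^ m ≤ (I / (m + 1)) ^ 1 :=
              pow_le_pow_of_le_one hδ0.le (by linarith) (by omega)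
          _ = _ := pow_one _
      have hδ2 : I / (m + 1) / (m + 1) ≤ I / (m + 1) := by
        rw [div_le_iff₀ (by positivity)]
        nlinarith
      simp only [hA, hC]
      rw [sub_div]
      linarith
    · rw [hAb]
      exact ha
  have hβ0 : 0 < β := lt_of_lt_of_le (by positivity) hβ1
  have hAmono : ∀ s₁ s₂, β ≤ s₁ → s₁ ≤ s₂ → s₂ ≤ α → A s₁ ≤ A s₂ := by
    intro s₁ s₂ h1 h2 h3
    refine monotoneOn_of_deriv_nonneg (convex_Icc β α)
      (fun s hs => (hAderiv s (hβ0.trans_le hs.1)).continuousAt.continuousWithinAt)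
      (fun s hs => ?_) (fun s hs => ?_) ⟨h1, h2.trans h3⟩ ⟨h1.trans h2, h3⟩ h2
    · rw [interior_Icc] at hs
      exact (hAderiv s (hβ0.trans hs.1)).differentiableAt.differentiableWithinAt
    · rw [interior_Icc] at hs
      have hs0 := hβ0.trans hs.1
      rw [(hAderiv s hs0).deriv]
      have := hC0 s hs0 hs.2.le
      positivity
  have hCanti : ∀ s₁ s₂, 0 < s₁ → s₁ ≤ s₂ → C s₂ ≤ C s₁ := by
    intro s₁ s₂ h1 h2
    simp only [hC]
    gcongr
  have hFα : F α * I ≤ fT (m + 1) (muT (m + 1)) := by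
    refine le_trans (le_of_eq ?_) (fT_le_fT_muT hm hα0 hα1)
    rw [fT_succ, ← hαI]
    simp only [hF, hA, hCα]
    ring
  have hFβ : F β * I ≤ fT (m + 1) (muT (m + 1)) := by
    refine le_trans (le_of_eq ?_) (fT_le_fT_muT hm (x := 1 - β) (by linarith) (by linarith))
    have hCβ : C β = 1 - β := by
      have : A β = 1 - β - C β := rfl
      linarith
    rw [fT_succ, ← hIC β hβ0, hCβ]
    simp only [hF, hAβ, zero_pow hm0]
    ring
  -- If F b exceeded both end values, F' would be positive somewhere left of b and negative
  -- somewhere right of it, while c / a decreases in s.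
  by_contra! hlt
  rw [← hFb] at hlt
  have hFbα : F α < F b := lt_of_mul_lt_mul_right (hFα.trans_lt hlt) hI0.le
  have hFbβ : F β < F b := lt_of_mul_lt_mul_right (hFβ.trans_lt hlt) hI0.le
  have q1 : β < b := lt_of_le_of_ne hβb (by rintro rfl; exact lt_irrefl _ hFbβ)
  have q2 : b < α := lt_of_le_of_ne hbα (by rintro rfl; exact lt_irrefl _ hFbα)
  obtain ⟨ξ₁, ⟨hξ₁, hξ₁'⟩, e1⟩ := exists_hasDerivAt_eq_slope F _ q1
    (fun s hs => (hFderiv s (hβ0.trans_le hs.1)).continuousAt.continuousWithinAt)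
    fun s hs => hFderiv s (hβ0.trans hs.1)
  obtain ⟨ξ₂, ⟨hξ₂, hξ₂'⟩, e2⟩ := exists_hasDerivAt_eq_slope F _ q2
    (fun s hs => (hFderiv s (hb.trans_le hs.1)).continuousAt.continuousWithinAt)
    fun s hs => hFderiv s (hb.trans hs.1)
  have hpos : 0 < (F b - F β) / (b - β) := by apply div_pos <;> linarith
  have hneg : (F α - F b) / (α - b) < 0 := by apply div_neg_of_neg_of_pos <;> linarith
  rw [← e1] at hpos
  rw [← e2] at hneg
  have d1 := pos_of_mul_pos_right hpos (by positivity : (0 : ℝ) ≤ m + 1)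
  have d2 := neg_of_mul_neg_right hneg (by positivity : (0 : ℝ) ≤ m + 1)
  have := add_pow_le_of_lt_of_le hm (hAβ ▸ hAmono β ξ₁ le_rfl hξ₁.le (hξ₁'.trans q2).le)
    (hAmono ξ₁ ξ₂ hξ₁.le (hξ₁'.trans hξ₂).le hξ₂'.le) (hC0 ξ₂ (hb.trans hξ₂) hξ₂'.le)
    (hCanti ξ₁ ξ₂ (hβ0.trans hξ₁) (hξ₁'.trans hξ₂).le) (by linarith)
  linarith

/-! ### The upper bound -/

/-- Raising A to (1 - B)^m gives exactly the three-block path with blocks (1 - B) x, y, B x. -/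
theorem mul_le_of_le_one_sub_pow {m : ℕ} (hm : 2 ≤ m) {x y A B : ℝ} (hx : 0 ≤ x) (hy : 0 ≤ y)
    (hxy : x + y = 1) (hB0 : 0 ≤ B) (hB1 : B ≤ 1) (h : A ≤ (1 - B) ^ m) :
    (x ^ m * (x + (m + 1) * y * A)) * (y ^ m * (y + (m + 1) * x * B)) ≤
      fT (m + 1) (muT (m + 1)) := by
  refine le_trans ?_ (three_block_le hm (a := (1 - B) * x) (b := y) (c := B * x)
    (mul_nonneg (by linarith) hx) hy (by positivity) (by linarith))
  have e : ((1 - B) * x + B * x) ^ (m + 1) + (m + 1) * ((1 - B) * x) ^ m * y =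
      x ^ m * (x + (m + 1) * y * (1 - B) ^ m) := by
    rw [mul_pow]
    ring
  rw [e, mul_assoc ((m : ℝ) + 1) x B, mul_comm x B]
  gcongr

theorem PathBound.mul_le {m : ℕ} (hm : 2 ≤ m) {x y K I : ℝ} (hx : 0 ≤ x) (hy : 0 ≤ y)
    (hxy : 0 < x + y) (hI : 0 ≤ I) (h : PathBound m x y K I) :
    (m + 1) * K * ((m + 1) * I) ≤ ((x + y) ^ (m + 1)) ^ 2 * fT (m + 1) (muT (m + 1)) := by
  obtain ⟨A, B, hA0, hA1, hB0, hB1, hAB, hK', hI'⟩ := h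
  have hx' : 0 ≤ x / (x + y) := by positivity
  have hy' : 0 ≤ y / (x + y) := by positivity
  have hs : x / (x + y) + y / (x + y) = 1 := by field_simp
  have key : ((x / (x + y)) ^ m * (x / (x + y) + (m + 1) * (y / (x + y)) * A)) *
      ((y / (x + y)) ^ m * (y / (x + y) + (m + 1) * (x / (x + y)) * B)) ≤
        fT (m + 1) (muT (m + 1)) := by
    rcases hAB with h | h
    · exact mul_le_of_le_one_sub_pow hm hx' hy' hs hB0 hB1 h
    · rw [mul_comm]
      exact mul_le_of_le_one_sub_pow hm hy' hx' (by linarith) hA0 hA1 h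
  calc (m + 1) * K * ((m + 1) * I)
      ≤ (x ^ m * (x + (m + 1) * y * A)) * (y ^ m * (y + (m + 1) * x * B)) := by gcongr
    _ = ((x + y) ^ (m + 1)) ^ 2 *
        (((x / (x + y)) ^ m * (x / (x + y) + (m + 1) * (y / (x + y)) * A)) *
          ((y / (x + y)) ^ m * (y / (x + y) + (m + 1) * (x / (x + y)) * B))) := by
        simp only [div_pow]
        field_simp
        ring
    _ ≤ _ := by gcongr

theorem numCliques_mul_numIndepSets_le {m : ℕ} (hm : 2 ≤ m) {V : Type*} [Fintype V]
    (G : SimpleGraph V) :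
    (numCliques G (m + 1) : ℝ) * (numIndepSets G (m + 1) : ℝ) ≤
      ((Fintype.card V : ℝ) ^ (m + 1) / ((m + 1).factorial : ℝ)) ^ 2 *
        fT (m + 1) (muT (m + 1)) := by
  rcases Nat.eq_zero_or_pos (Fintype.card V) with h0 | hpos
  · have : numCliques G (m + 1) = 0 := by
      have hV : IsEmpty V := Fintype.card_eq_zero_iff.1 h0
      have : {s : Finset V | G.IsNClique (m + 1) s} = ∅ := by
        refine Set.eq_empty_of_forall_notMem fun s hs => ?_
        have h1 := hs.card_eq
        rw [Finset.eq_empty_of_isEmpty s, Finset.card_empty] at h1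
        omega
      rw [numCliques, this, Set.ncard_empty]
    rw [this, h0]
    simp
  · obtain ⟨c, hc, hk, hi⟩ := exists_thresholdGraph_dominating G (Fintype.card V - 1)
      (by rw [Nat.card_eq_fintype_card]; omega)
    have h0 : PathBound m ((0 : ℕ) : ℝ) ((0 : ℕ) : ℝ) 0 0 :=
      ⟨0, 0, le_rfl, zero_le_one, le_rfl, zero_le_one, Or.inl (by simp), by simp, by simp⟩
    obtain ⟨X, Y, hX, hY, hXY, hP⟩ := exists_pathBound_prefixChooseSum hm c 0 0 h0
    have hXY' : X + Y = Fintype.card V := by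
      rw [hXY, hc, Nat.cast_sub hpos]
      push_cast
      ring
    have hpos' : (0 : ℝ) < Fintype.card V := by exact_mod_cast hpos
    have key := hP.mul_le hm hX hY (by rw [hXY']; exact hpos') (by positivity)
    rw [← numCliques_thresholdGraph, ← numCliques_thresholdGraph, ← numIndepSets_thresholdGraph,
      hXY', zero_add, zero_add] at key
    rw [div_pow, div_mul_eq_mul_div, le_div_iff₀ (by positivity)]
    refine le_trans ?_ key
    have e : ((m + 1).factorial : ℝ) = (m + 1) * m.factorial := by
      rw [Nat.factorial_succ]
      push_cast
      ring
    have hk' : (numCliques G (m + 1) : ℝ) ≤ numCliques (thresholdGraph c) (m + 1) := by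
      exact_mod_cast hk (m + 1)
    have hi' : (numIndepSets G (m + 1) : ℝ) ≤ numIndepSets (thresholdGraph c) (m + 1) := by
      exact_mod_cast hi (m + 1)
    calc (numCliques G (m + 1) : ℝ) * numIndepSets G (m + 1) * ((m + 1).factorial : ℝ) ^ 2
        ≤ (numCliques (thresholdGraph c) (m + 1) : ℝ) * numIndepSets (thresholdGraph c) (m + 1) *
          ((m + 1).factorial : ℝ) ^ 2 := by gcongr
      _ = _ := by rw [e]; ring
-- Tightness on two-block codes
open Asymptotics Filter

theorem exists_isRounding {m : ℕ} (hm : 2 ≤ m) (n : ℕ) (hn : 1 ≤ n) :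
    ∃ a b : ℕ, IsRounding (m + 1) n a b := by
  obtain ⟨hμ0, hμ1, -⟩ := muT_mem_and_quadratic hm
  have hn' : (1 : ℝ) ≤ n := by exact_mod_cast hn
  have hμn : 0 ≤ muT (m + 1) * n := by positivity
  have hle := Nat.floor_le hμn
  have hlt := Nat.lt_floor_add_one (muT (m + 1) * n)
  have hb : ⌊muT (m + 1) * n⌋₊ < n := by
    rw [Nat.floor_lt hμn]
    nlinarith
  -- With b the floor of μn, a - (1 - μ) n = (μn - b) - 1 lies in [-1, 0).
  obtain ⟨a, ha⟩ : ∃ a, a + ⌊muT (m + 1) * n⌋₊ + 1 = n := ⟨n - 1 - ⌊muT (m + 1) * n⌋₊, by omega⟩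
  refine ⟨a, ⌊muT (m + 1) * n⌋₊, ha, ?_, ?_⟩
  · have ha' : (a : ℝ) + (⌊muT (m + 1) * n⌋₊ : ℝ) + 1 = n := by exact_mod_cast ha
    rw [abs_le]
    constructor <;> linarith
  · rw [abs_le]
    constructor <;> linarith

theorem prefixChooseSum_minus (m x b : ℕ) :
    prefixChooseSum m x (List.replicate b CodeSymbol.minus) = (b + 1) * x.choose m := by
  induction b with
  | zero => simp [prefixChooseSum]
  | succ b ih => rw [List.replicate_succ, prefixChooseSum, ih]; ring

/-- Hockey-stick summation over the block of symbols `+`. -/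
theorem prefixChooseSum_plus (m x a : ℕ) (c : List CodeSymbol) :
    prefixChooseSum m x (List.replicate a CodeSymbol.plus ++ c) + x.choose (m + 1) =
      (x + a).choose (m + 1) + prefixChooseSum m (x + a) c := by
  induction a generalizing x with
  | zero => simp [add_comm]
  | succ a ih =>
    have h := ih (x + 1)
    have h' : (x + 1).choose (m + 1) = x.choose m + x.choose (m + 1) := Nat.choose_succ_succ x m
    rw [List.replicate_succ, List.cons_append, prefixChooseSum,
      show x + (a + 1) = x + 1 + a by ring]
    omega

theorem numCliques_codePlusMinus (a b m : ℕ) :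
    numCliques (thresholdGraph (codePlusMinus a b)) (m + 1) =
      a.choose (m + 1) + (b + 1) * a.choose m := by
  have h := prefixChooseSum_plus m 0 a (List.replicate b CodeSymbol.minus)
  rw [Nat.choose_zero_succ, add_zero, zero_add, prefixChooseSum_minus] at h
  rw [numCliques_thresholdGraph, codePlusMinus, h]

theorem prefixChooseSum_minus_append (m b : ℕ) (c : List CodeSymbol) :
    prefixChooseSum (m + 1) 0 (List.replicate b CodeSymbol.minus ++ c) =
      prefixChooseSum (m + 1) 0 c := by
  induction b with
  | zero => simp
  | succ b ih =>
    rw [List.replicate_succ, List.cons_append, prefixChooseSum, ih, Nat.choose_zero_succ, zero_add]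

theorem numCliques_codeMinusPlus (a b m : ℕ) :
    numCliques (thresholdGraph (codeMinusPlus a b)) (m + 2) = (b + 1).choose (m + 2) := by
  have h := prefixChooseSum_plus (m + 1) 0 b []
  rw [Nat.choose_zero_succ, add_zero, zero_add, List.append_nil, prefixChooseSum] at h
  rw [numCliques_thresholdGraph, codeMinusPlus, prefixChooseSum_minus_append, h,
    Nat.choose_succ_succ b (m + 1), add_comm]

theorem map_flip_codePlusMinus (a b : ℕ) :
    (codePlusMinus a b).map CodeSymbol.flip = codeMinusPlus a b := by
  simp [codePlusMinus, codeMinusPlus, CodeSymbol.flip]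

theorem map_flip_codeMinusPlus (a b : ℕ) :
    (codeMinusPlus a b).map CodeSymbol.flip = codePlusMinus a b := by
  simp [codePlusMinus, codeMinusPlus, CodeSymbol.flip]

/-- Binomial coefficients with a fixed lower entry depend on the upper entry as a power does, up to
lower order terms. -/
theorem isBigO_choose_sub_pow {α : Type*} {l : Filter α} {x : α → ℕ} {g N : α → ℝ}
    (hxg : (fun p => (x p : ℝ) - g p) =O[l] fun _ => (1 : ℝ)) (hg : g =O[l] N)
    (hN : (fun _ => (1 : ℝ)) =O[l] N) (t : ℕ) :
    (fun p => (((x p).choose t : ℝ) - g p ^ t / t.factorial) * N p) =O[l] fun p => N p ^ t := by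
  -- The factor N on the left expresses an error of order N^(t-1) without a subtraction in the
  -- exponent.
  induction t with
  | zero => exact IsBigO.congr_left (f₁ := fun _ => (0 : ℝ)) (isBigO_zero _ l) fun p => by simp
  | succ t ih =>
    have hxt : (fun p => (x p : ℝ) - t - g p) =O[l] fun _ => (1 : ℝ) := by
      have := hxg.sub (isBigO_const_const (t : ℝ) one_ne_zero l)
      exact this.congr_left fun p => by ring
    have hx : (fun p => (x p : ℝ) - t) =O[l] N := by
      have := (hxt.trans hN).add hg
      exact this.congr_left fun p => by ring
    have h1 := ih.mul hx
    have h2 := ((hg.pow t).mul (hxt.mul (isBigO_refl N l))).const_mul_left ((t.factorial : ℝ)⁻¹)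
    have h3 := (h1.add (h2.congr_right (g₂ := fun p => N p ^ t * N p) fun p => by ring)).const_mul_left
      (((t : ℝ) + 1)⁻¹)
    refine (h3.congr_left fun p => ?_).congr_right fun p => (pow_succ _ _).symm
    -- For x < t the real factor x - t is negative, but both binomials vanish.
    have hrec : ((x p).choose (t + 1) : ℝ) * (t + 1) = (x p).choose t * ((x p : ℝ) - t) := by
      rcases le_or_gt t (x p) with h | h
      · have := Nat.choose_succ_right_eq (x p) t
        rw [← Nat.cast_sub h]
        exact_mod_cast this
      · rw [Nat.choose_eq_zero_of_lt h, Nat.choose_eq_zero_of_lt (by omega : x p < t + 1)]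
        simp
    have hrec' : ((x p).choose (t + 1) : ℝ) = (x p).choose t * ((x p : ℝ) - t) / (t + 1) := by
      rw [← hrec]
      field_simp
    rw [hrec', Nat.factorial_succ]
    push_cast
    field_simp
    ring

theorem isBigO_choose {α : Type*} {l : Filter α} {x : α → ℕ} {g N : α → ℝ}
    (hxg : (fun p => (x p : ℝ) - g p) =O[l] fun _ => (1 : ℝ)) (hg : g =O[l] N)
    (hN : (fun _ => (1 : ℝ)) =O[l] N) (t : ℕ) :
    (fun p => ((x p).choose t : ℝ)) =O[l] fun p => N p ^ t := by
  have hx : (fun p => (x p : ℝ)) =O[l] N := by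
    have := (hxg.trans hN).add hg
    exact this.congr_left fun p => by ring
  refine IsBigO.trans ?_ (hx.pow t)
  refine isBigO_of_le _ fun p => ?_
  rw [Real.norm_of_nonneg (by positivity), Real.norm_of_nonneg (by positivity)]
  exact_mod_cast Nat.choose_le_pow (x p) t

/-- The extremal product of a clique count and an independent set count. -/
theorem exists_abs_choose_mul_sub_le {m : ℕ} (hm : 2 ≤ m) :
    ∃ C : ℝ, ∀ n a b : ℕ, IsRounding (m + 1) n a b →
      |(((a.choose (m + 1) + (b + 1) * a.choose m : ℕ) : ℝ) * ((b + 1).choose (m + 1) : ℕ))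
          - ((n : ℝ) ^ (m + 1) / ((m + 1).factorial : ℝ)) ^ 2 * fT (m + 1) (muT (m + 1))| ≤
        C * (n : ℝ) ^ (2 * (m + 1) - 1) := by
  set μ := muT (m + 1)
  set S : Set (ℕ × ℕ × ℕ) := {p | IsRounding (m + 1) p.1 p.2.1 p.2.2} with hS
  -- For the principal filter of all roundings, big-O means one constant valid for every rounding.
  set l : Filter (ℕ × ℕ × ℕ) := 𝓟 S
  set N : ℕ × ℕ × ℕ → ℝ := fun p => (p.1 : ℝ) with hNdef
  have hN1 : ∀ p ∈ S, 1 ≤ N p := by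
    intro p hp
    have : 1 ≤ p.1 := by have := hp.1; omega
    exact Nat.one_le_cast.2 this
  have hN : (fun _ => (1 : ℝ)) =O[l] N := by
    refine isBigO_principal.2 ⟨1, fun p hp => ?_⟩
    have := hN1 p hp
    rw [norm_one, one_mul, Real.norm_of_nonneg (by linarith)]
    exact this
  have ha : (fun p : ℕ × ℕ × ℕ => (p.2.1 : ℝ) - (1 - μ) * N p) =O[l] fun _ => (1 : ℝ) :=
    isBigO_principal.2 ⟨1, fun p hp => by simpa using hp.2.1⟩
  have hb : (fun p : ℕ × ℕ × ℕ => ((p.2.2 + 1 : ℕ) : ℝ) - μ * N p) =O[l] fun _ => (1 : ℝ) := by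
    refine isBigO_principal.2 ⟨2, fun p hp => ?_⟩
    have h := abs_le.1 hp.2.2
    rw [Real.norm_eq_abs, norm_one, abs_le]
    simp only [hNdef]
    push_cast
    constructor <;> linarith [h.1, h.2]
  have hga : (fun p => (1 - μ) * N p) =O[l] N := (isBigO_refl N l).const_mul_left _
  have hgb : (fun p => μ * N p) =O[l] N := (isBigO_refl N l).const_mul_left _
  have ka1 := isBigO_choose_sub_pow ha hga hN (m + 1)
  have ka2 := isBigO_choose_sub_pow ha hga hN m
  have ka3 := isBigO_choose ha hga hN m
  have kb := isBigO_choose_sub_pow hb hgb hN (m + 1)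
  have kb2 := isBigO_choose hb hgb hN (m + 1)
  have hk : (fun p : ℕ × ℕ × ℕ => ((p.2.1.choose (m + 1) + (p.2.2 + 1) * p.2.1.choose m : ℕ) -
      (((1 - μ) * N p) ^ (m + 1) / (m + 1).factorial +
        μ * N p * (((1 - μ) * N p) ^ m / m.factorial))) * N p) =O[l] fun p => N p ^ (m + 1) := by
    have h1 := (ka3.mul (hb.mul (isBigO_refl N l))).congr_right
      (g₂ := fun p => N p ^ (m + 1)) fun p => by ring
    have h2 := (hgb.mul ka2).congr_right (g₂ := fun p => N p ^ (m + 1)) fun p => by ring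
    refine ((ka1.add h1).add h2).congr_left fun p => ?_
    push_cast
    ring
  have hk0 : (fun p => ((1 - μ) * N p) ^ (m + 1) / (m + 1).factorial +
        μ * N p * (((1 - μ) * N p) ^ m / m.factorial)) =O[l] fun p => N p ^ (m + 1) := by
    refine ((isBigO_refl (fun p => N p ^ (m + 1)) l).const_mul_left
      ((1 - μ) ^ (m + 1) / (m + 1).factorial + μ * ((1 - μ) ^ m / m.factorial))).congr_left
        fun p => ?_
    rw [mul_pow, mul_pow]
    ring
  -- KI - K₀I₀ = (K - K₀) I + K₀ (I - I₀), still multiplied by N; this factor is cancelled at the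
  -- end.
  have htot := (hk.mul kb2).add (hk0.mul kb)
  obtain ⟨C, hC⟩ := isBigO_principal.1 htot
  refine ⟨C, fun n a b h => ?_⟩
  have hn1 : (1 : ℝ) ≤ n := hN1 (n, a, b) h
  have hn0 : (0 : ℝ) < n := by linarith
  have hCn := hC (n, a, b) h
  simp only [hNdef] at hCn
  rw [Real.norm_eq_abs, Real.norm_of_nonneg (by positivity)] at hCn
  refine le_of_mul_le_mul_right (le_of_eq_of_le ?_ (hCn.trans_eq ?_)) hn0
  · nth_rewrite 2 [← abs_of_pos hn0]
    rw [← abs_mul]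
    congr 1
    rw [fT_succ, Nat.factorial_succ]
    push_cast
    rw [mul_pow, mul_pow, mul_pow]
    field_simp
    ring
  · rw [mul_assoc, ← pow_succ, ← pow_add]
    congr 2
    omega

theorem mainTheorem1 (t : ℕ) (ht : 3 ≤ t) :
    (∃ C : ℝ, ∀ (V : Type*) [Fintype V] (G : SimpleGraph V),
      (numCliques G t : ℝ) * (numIndepSets G t : ℝ) ≤
        ((Fintype.card V : ℝ) ^ t / (t.factorial : ℝ)) ^ 2 * fT t (muT t)
          + C * (Fintype.card V : ℝ) ^ (2 * t - 1)) ∧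
    (∀ n : ℕ, 1 ≤ n → ∃ a b : ℕ, IsRounding t n a b) ∧
    (∃ C : ℝ, ∀ n a b : ℕ, IsRounding t n a b →
      |(numCliques (thresholdGraph (codePlusMinus a b)) t : ℝ)
            * (numIndepSets (thresholdGraph (codePlusMinus a b)) t : ℝ)
          - ((n : ℝ) ^ t / (t.factorial : ℝ)) ^ 2 * fT t (muT t)| ≤ C * (n : ℝ) ^ (2 * t - 1) ∧
      |(numCliques (thresholdGraph (codeMinusPlus a b)) t : ℝ)
            * (numIndepSets (thresholdGraph (codeMinusPlus a b)) t : ℝ)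
          - ((n : ℝ) ^ t / (t.factorial : ℝ)) ^ 2 * fT t (muT t)| ≤ C * (n : ℝ) ^ (2 * t - 1)) := by
  obtain ⟨m, rfl⟩ : ∃ m, t = m + 2 := ⟨t - 2, by omega⟩
  have hm : 2 ≤ m + 1 := by omega
  refine ⟨⟨0, fun V _ G => ?_⟩, exists_isRounding hm, ?_⟩
  · rw [zero_mul, add_zero]
    exact numCliques_mul_numIndepSets_le hm G
  · obtain ⟨C, hC⟩ := exists_abs_choose_mul_sub_le hm
    refine ⟨C, fun n a b h => ?_⟩
    have hn := hC n a b h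
    -- The two codes have complementary graphs, so both products have the same two factors.
    rw [numIndepSets_thresholdGraph, numIndepSets_thresholdGraph, map_flip_codePlusMinus,
      map_flip_codeMinusPlus, numCliques_codeMinusPlus, numCliques_codePlusMinus]
    exact ⟨hn, by rwa [mul_comm ((b + 1).choose (m + 2) : ℝ)]⟩
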